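/- For $t \ge 3$ let $S_t^+$ denote the graph on $t$ vertices obtained from the star with $t$ vertices (one center and $t-1$ leaves) by adding one edge joining two of the leaves. For graphs $G,H$ and an integer $k\ge 1$, let $gr_k(G:H)$ denote the minimum integer $m$ such that every coloring of the edges of the complete graph $K_m$ with (at most) $k$ colors contains a rainbow copy of $G$ (a copy whose edges have pairwise different colors) or a monochromatic copy of $H$. Let $k \ge 1$ and $t \ge 3$ be integers, and if $t = 3$ assume that $k$ is odd. Then $$ gr_k(K_3 : S_t^+) = \begin{cases} 2(t-1)\cdot 5^{\frac{k-2}{2}} + 1 & \text{if } k \text{ is even},\\ (t-1)\cdot 5^{\frac{k-1}{2}} + 1 & \text{if } k \text{ is odd}. \end{cases} $$ -/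

import Mathlib

namespace GallaiRamsey

/-- `C` is an edge-coloring of the complete graph on `V`. It contains a rainbow copy of `G` if some
copy of `G` has pairwise differently colored edges. -/
def HasRainbowCopy {V W K : Type*} (C : SimpleGraph.TopEdgeLabeling V K) (G : SimpleGraph W) :
    Prop :=
  ∃ f : SimpleGraph.Copy G (⊤ : SimpleGraph V),
    Function.Injective fun e : G.edgeSet => C (f.mapEdgeSet e)

/-- `C` contains a monochromatic copy of `H`: for some color `i`, the graph formed by the edges of
color `i` contains a (not necessarily induced) copy of `H`. -/
def HasMonochromaticCopy {V W K : Type*} (C : SimpleGraph.TopEdgeLabeling V K)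
    (H : SimpleGraph W) : Prop :=
  ∃ i : K, H.IsContained (C.labelGraph i)

/-- `m` is the Gallai-Ramsey number `gr_k(G : H)`: the minimum `m` such that every coloring of the
edges of the complete graph on `m` vertices with colors from a set of `k` colors contains a rainbow
copy of `G` or a monochromatic copy of `H`. -/
def IsGallaiRamseyNumber {U W : Type*} (k : ℕ) (G : SimpleGraph U) (H : SimpleGraph W) (m : ℕ) :
    Prop :=
  IsLeast {n : ℕ | ∀ C : SimpleGraph.TopEdgeLabeling (Fin n) (Fin k),
    HasRainbowCopy C G ∨ HasMonochromaticCopy C H} m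

/-- The graph `S_t^+`: the star with center `0` on the `t` vertices `0, …, t - 1`, together with an
edge joining the two leaves `1` and `2`. -/
def starPlus (t : ℕ) (ht : 3 ≤ t) : SimpleGraph (Fin t) :=
  SimpleGraph.starGraph (⟨0, by omega⟩ : Fin t) ⊔
    SimpleGraph.edge (⟨1, by omega⟩ : Fin t) ⟨2, by omega⟩

end GallaiRamsey

namespace GallaiRamsey

/-! Put N = t - 1 and consider colorings without rainbow triangles. By Gallai's theorem
(`IsGallai.exists_partition`) the vertices split into classes with a single color between any two of
them, at most two colors r, b being used in all, each occurring at every class. A class with at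
least N vertices contains no edge of color r or b: some outside vertex sees the whole class in that
color, and such an edge would complete a monochromatic `S_t^+`. So if r ≠ b, every class obeys the
bound for k - 2 colors, and the r- and b-neighborhoods of a vertex outside its class are at most
twice as large: a factor 5 for two colors. If r = b, one color costs a factor 2
(`IsGallai.card_le_of_bounds`). The resulting recursion is `extremalOrder`.

For two colors the bound is max (2N) 5. The 5 comes from the pentagon coloring of K_5 and exceeds 2N
only when N = 2, which is why t = 3 with k even is excluded.

For sharpness, start from a monochromatic K_N and substitute it repeatedly into the pentagon
coloring (two new colors, factor 5), after one doubling (one new color) if k is even. -/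

/-- A symmetric coloring of the pairs of vertices without rainbow triangles. The values on the
diagonal are irrelevant. -/
structure IsGallai {V K : Type*} (c : V → V → K) : Prop where
  symm : ∀ x y, c x y = c y x
  triangle : ∀ x y z, x ≠ y → y ≠ z → x ≠ z → c x y = c y z ∨ c y z = c x z ∨ c x y = c x z

/-! ### Gallai's structure theorem -/

section Gallai

variable {V K : Type*} {c : V → V → K}

theorem IsGallai.eq_of_ne (hc : IsGallai c) {x y z : V} (hxy : x ≠ y) (hyz : y ≠ z) (hxz : x ≠ z)
    (h₁ : c x z ≠ c x y) (h₂ : c y z ≠ c x y) : c x z = c y z := by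
  rcases hc.triangle x y z hxy hyz hxz with h | h | h
  · exact absurd h.symm h₂
  · exact h.symm
  · exact absurd h.symm h₁

/-- The edges of color `i` inside `T`. -/
def ColorStep (c : V → V → K) (T : Finset V) (i : K) (x y : V) : Prop :=
  x ∈ T ∧ y ∈ T ∧ x ≠ y ∧ c x y = i

/-- `y` can be reached from `x` along edges of color `i` inside `T`. -/
abbrev ColorReach (c : V → V → K) (T : Finset V) (i : K) : V → V → Prop :=
  Relation.ReflTransGen (ColorStep c T i)

/-- The edges of color `i` form a connected graph on `T`. -/
def ColorConnected (c : V → V → K) (T : Finset V) (i : K) : Prop :=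
  ∀ x ∈ T, ∀ y ∈ T, ColorReach c T i x y

theorem ColorReach.symm (hc : IsGallai c) {T : Finset V} {i : K} {x y : V}
    (h : ColorReach c T i x y) : ColorReach c T i y x := by
  have : Std.Symm (ColorStep c T i) :=
    ⟨fun _ _ ⟨ha, hb, hne, he⟩ => ⟨hb, ha, hne.symm, (hc.symm _ _).trans he⟩⟩
  exact Relation.ReflTransGen.stdSymm.symm _ _ h

/-- A vertex sends a single color to each component of a color class not containing it. -/
theorem IsGallai.eq_of_colorReach (hc : IsGallai c) {T : Finset V} {i : K} {x x' y : V}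
    (h : ColorReach c T i x x') (hy : y ∈ T) (hxy : ¬ ColorReach c T i x y) :
    c x y = c x' y := by
  induction h with
  | refl => rfl
  | @tail a b hxa hab ih =>
    obtain ⟨ha, hb, hne, he⟩ := hab
    have hxb : ColorReach c T i x b := hxa.tail ⟨ha, hb, hne, he⟩
    have hay : a ≠ y := fun h => hxy (h ▸ hxa)
    have hby : b ≠ y := fun h => hxy (h ▸ hxb)
    rw [ih]
    refine hc.eq_of_ne hne hby hay ?_ ?_
    · rw [he]; exact fun h => hxy (hxa.tail ⟨ha, hy, hay, h⟩)
    · rw [he]; exact fun h => hxy (hxb.tail ⟨hb, hy, hby, h⟩)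

/-- A path from `x` to `v` must leave `T`, and its first exit is an edge to `v`; so every component
of color `i` in `T` has such an edge. -/
theorem exists_colorReach_of_insert [DecidableEq V] {T : Finset V} {i : K} {v x : V}
    (hv : v ∉ T) (hx : x ∈ T) (h : ColorConnected c (insert v T) i) :
    ∃ a ∈ T, ColorReach c T i x a ∧ c a v = i := by
  have key : ∀ y, ColorReach c (insert v T) i x y →
      (y ∈ T ∧ ColorReach c T i x y) ∨ ∃ a ∈ T, ColorReach c T i x a ∧ c a v = i := by
    intro y hy
    induction hy with
    | refl => exact .inl ⟨hx, .refl⟩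
    | @tail a b _ hab ih =>
      rcases ih with ⟨ha, hxa⟩ | h
      · obtain ⟨-, hb, hne, he⟩ := hab
        rcases Finset.mem_insert.1 hb with rfl | hb
        · exact .inr ⟨a, ha, hxa, he⟩
        · exact .inl ⟨hb, hxa.tail ⟨ha, hb, hne, he⟩⟩
      · exact .inr h
  rcases key v (h x (Finset.mem_insert_of_mem hx) v (Finset.mem_insert_self _ _)) with h | h
  · exact absurd h.1 hv
  · exact h

theorem IsGallai.colorConnected_of_insert [DecidableEq V] (hc : IsGallai c) {T : Finset V}
    {i j h : K} {v : V} (hij : i ≠ j) (hih : i ≠ h) (hjh : j ≠ h) (hv : v ∉ T)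
    (hi : ColorConnected c (insert v T) i) (hj : ColorConnected c (insert v T) j)
    (hh : ColorConnected c (insert v T) h) : ColorConnected c T i := by
  intro p hp q hq
  by_contra hpq
  -- If deleting `v` disconnects color `i`, every component still has an `i`-neighbor of `v`.
  -- Playing these against a `j`-neighbor `x` and an `h`-neighbor `z` of `v` forces one edge, or one
  -- vertex-component pair, to have both colors `j` and `h`.
  obtain ⟨x, hx, -, hxv⟩ := exists_colorReach_of_insert hv hp hj
  obtain ⟨z, hz, -, hzv⟩ := exists_colorReach_of_insert hv hp hh
  have cross : ∀ x ∈ T, ∀ b ∈ T, c x v ≠ i → c b v = i → ¬ ColorReach c T i x b →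
      c x b = c x v := by
    intro x hx b hb hxi hbi hxb
    have hne : x ≠ b := fun h => hxb (h ▸ .refl)
    have hxv : x ≠ v := fun h => hv (h ▸ hx)
    have hbv : b ≠ v := fun h => hv (h ▸ hb)
    rcases hc.triangle x b v hne hbv hxv with h | h | h
    · exact absurd (Relation.ReflTransGen.single ⟨hx, hb, hne, h.trans hbi⟩) hxb
    · exact absurd (h.symm.trans hbi) hxi
    · exact h
  have hxi : c x v ≠ i := fun e => hij (e.symm.trans hxv)
  have hzi : c z v ≠ i := fun e => hih (e.symm.trans hzv)
  by_cases hxz : ColorReach c T i x z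
  · obtain ⟨y, hy, hxy⟩ : ∃ y ∈ T, ¬ ColorReach c T i x y := by
      by_contra! hall
      exact hpq (((hall p hp).symm hc).trans (hall q hq))
    obtain ⟨b, hb, hyb, hbv⟩ := exists_colorReach_of_insert hv hy hi
    have hxb : ¬ ColorReach c T i x b := fun e => hxy (e.trans (hyb.symm hc))
    have hzb : ¬ ColorReach c T i z b := fun e => hxb (hxz.trans e)
    have e := hc.eq_of_colorReach hxz hb hxb
    rw [cross x hx b hb hxi hbv hxb, cross z hz b hb hzi hbv hzb, hxv, hzv] at e
    exact hjh e
  · obtain ⟨a, ha, hxa, hav⟩ := exists_colorReach_of_insert hv hx hi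
    obtain ⟨b, hb, hzb, hbv⟩ := exists_colorReach_of_insert hv hz hi
    have hxb : ¬ ColorReach c T i x b := fun e => hxz (e.trans (hzb.symm hc))
    have hza : ¬ ColorReach c T i z a := fun e => hxz (hxa.trans (e.symm hc))
    have e₁ := hc.eq_of_colorReach hxa hz hxz
    have e₂ := hc.eq_of_colorReach hzb hx (fun e => hxz (e.symm hc))
    have e₃ := cross x hx b hb hxi hbv hxb
    have e₄ := cross z hz a ha hzi hav hza
    rw [hc.symm] at e₃ e₄
    rw [hc.symm z x, e₁, e₄, e₃, hxv, hzv] at e₂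
    exact hjh e₂.symm

/-- In a coloring without rainbow triangles, three different colors cannot all be connected. -/
theorem IsGallai.not_colorConnected [DecidableEq V] (hc : IsGallai c) {i j h : K}
    (hij : i ≠ j) (hih : i ≠ h) (hjh : j ≠ h) (T : Finset V) (hT : 2 ≤ T.card) :
    ¬ (ColorConnected c T i ∧ ColorConnected c T j ∧ ColorConnected c T h) := by
  induction T using Finset.induction_on with
  | empty => simp at hT
  | @insert v T hv ih =>
    rintro ⟨hi, hj, hh⟩
    rw [Finset.card_insert_of_notMem hv] at hT
    rcases (show 1 ≤ T.card by omega).eq_or_lt with h1 | h2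
    · obtain ⟨x, rfl⟩ := Finset.card_eq_one.1 h1.symm
      obtain ⟨a, ha, -, hai⟩ := exists_colorReach_of_insert hv (Finset.mem_singleton_self x) hi
      obtain ⟨b, hb, -, hbj⟩ := exists_colorReach_of_insert hv (Finset.mem_singleton_self x) hj
      rw [Finset.mem_singleton] at ha hb
      subst ha hb
      exact hij (hai.symm.trans hbj)
    · exact ih h2 ⟨hc.colorConnected_of_insert hij hih hjh hv hi hj hh,
        hc.colorConnected_of_insert hij.symm hjh hih hv hj hi hh,
        hc.colorConnected_of_insert hih.symm hjh.symm hij hv hh hi hj⟩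

/-- The color of an edge between different classes of `s` depends only on the two classes. -/
def IsHomogeneous (c : V → V → K) (s : Setoid V) : Prop :=
  ∀ x x' y, s x x' → ¬ s x y → c x y = c x' y

/-- The setoid obtained from `s` by joining classes connected by edges of color `i`. -/
def joinColor (hc : IsGallai c) (s : Setoid V) (i : K) : Setoid V where
  r := Relation.ReflTransGen fun x y => s x y ∨ (¬ s x y ∧ c x y = i)
  iseqv :=
    { refl := fun _ => .refl
      symm := fun {_ _} h => by
        have : Std.Symm fun x y => s x y ∨ (¬ s x y ∧ c x y = i) := by
          constructor
          rintro a b (h | ⟨h, e⟩)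
          · exact .inl (s.symm h)
          · exact .inr ⟨fun h' => h (s.symm h'), (hc.symm _ _).trans e⟩
        exact Relation.ReflTransGen.stdSymm.symm _ _ h
      trans := fun {_ _ _} h h' => h.trans h' }

/-- If `y` lies outside the joined class, an edge `a b` of color `i` inside it forms a triangle
whose other two edges avoid `i`, so they agree. -/
theorem isHomogeneous_joinColor (hc : IsGallai c) {s : Setoid V} (hs : IsHomogeneous c s) (i : K) :
    IsHomogeneous c (joinColor hc s i) := by
  intro x x' y h hxy
  induction h with
  | refl => rfl
  | @tail a b hxa hab ih =>
    rw [ih]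
    have hxb := hxa.tail hab
    have hay : ¬ s a y := fun h => hxy (hxa.tail (.inl h))
    have hby : ¬ s b y := fun h => hxy (hxb.tail (.inl h))
    rcases hab with hab | ⟨hab, he⟩
    · exact hs _ _ _ hab hay
    · have ne : ∀ {p q}, ¬ s p q → p ≠ q := fun h e => h (e ▸ s.refl _)
      refine hc.eq_of_ne (ne hab) (ne hby) (ne hay) ?_ ?_
      · rw [he]; exact fun h => hxy (hxa.tail (.inr ⟨hay, h⟩))
      · rw [he]; exact fun h => hxy (hxb.tail (.inr ⟨hby, h⟩))

/-- Gallai's structure theorem: there is a nontrivial homogeneous partition with at most two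
colors between its classes, and each of these colors occurs at each class. -/
theorem IsGallai.exists_partition [Finite V] [Nontrivial V] (hc : IsGallai c) :
    ∃ (s : Setoid V) (r b : K), IsHomogeneous c s ∧
      (∀ x y, ¬ s x y → c x y = r ∨ c x y = b) ∧
      (∀ x, ∃ y, ¬ s x y ∧ c x y = r) ∧ (∀ x, ∃ y, ¬ s x y ∧ c x y = b) := by
  classical
  have : Finite (Setoid V) :=
    Finite.of_injective (fun s : Setoid V => (fun x y => s x y : V → V → Prop))
      (fun s t h => Setoid.ext fun x y => by simpa using congrFun (congrFun h x) y)
  -- Take a coarsest proper homogeneous partition. Joining its classes along any color occurring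
  -- between them must then give everything, so each such color is connected on a set of
  -- representatives, and three colors are impossible.
  obtain ⟨s, hs⟩ := (Set.toFinite {s : Setoid V | IsHomogeneous c s ∧ s ≠ ⊤}).exists_maximal
    ⟨⊥, by
      refine ⟨?_, fun h => ?_⟩
      · rintro x x' y h -
        rw [show x = x' from h]
      · obtain ⟨x, y, hxy⟩ := exists_pair_ne V
        refine hxy (show (⊥ : Setoid V) x y from ?_)
        rw [h]
        trivial⟩
  obtain ⟨⟨hom, htop⟩, hmax⟩ := hs
  have join : ∀ i, (∃ x y, ¬ s x y ∧ c x y = i) → ∀ x y, joinColor hc s i x y := by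
    rintro i ⟨x, y, hxy, he⟩
    by_contra hne
    refine hxy (hmax (y := joinColor hc s i) ⟨isHomogeneous_joinColor hc hom i, ?_⟩
      (fun p q h => .single (.inl h)) (.single (.inr ⟨hxy, he⟩)))
    intro h
    exact hne fun p q => by rw [h]; trivial
  obtain ⟨x₀, y₀, h₀⟩ : ∃ x y, ¬ s x y := by
    by_contra! h
    exact htop (Setoid.ext fun x y => ⟨fun _ => trivial, fun _ => h x y⟩)
  have occurs : ∀ i, (∃ x y, ¬ s x y ∧ c x y = i) → ∀ x, ∃ y, ¬ s x y ∧ c x y = i := by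
    intro i hi x
    by_contra! hx
    have stay : ∀ y, joinColor hc s i x y → s x y := by
      intro y h
      induction h with
      | refl => exact s.refl _
      | @tail a b _ hab ih =>
        rcases hab with hab | ⟨hab, he⟩
        · exact s.trans ih hab
        · have hxb : ¬ s x b := fun h => hab (s.trans (s.symm ih) h)
          refine absurd ?_ (hx b hxb)
          rw [hom x a b ih hxb, he]
    exact h₀ (s.trans (s.symm (stay x₀ (join i hi x x₀))) (stay y₀ (join i hi x y₀)))
  have : Fintype V := Fintype.ofFinite V
  let rep : V → V := fun x => Quotient.out (Quotient.mk s x)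
  have hrep : ∀ x, s (rep x) x := fun x => Quotient.mk_out (s := s) x
  have rep_eq : ∀ x y, s x y → rep x = rep y := fun x y h => by
    simp only [rep]; rw [Quotient.sound h]
  have rep_rep : ∀ x, rep (rep x) = rep x := fun x => rep_eq _ _ (hrep x)
  let T : Finset V := Finset.univ.image rep
  have hT : ∀ x, rep x ∈ T := fun x => Finset.mem_image_of_mem _ (Finset.mem_univ _)
  have conn : ∀ i, (∃ x y, ¬ s x y ∧ c x y = i) → ColorConnected c T i := by
    intro i hi
    have key : ∀ x y, joinColor hc s i x y → ColorReach c T i (rep x) (rep y) := by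
      intro x y h
      induction h with
      | refl => exact .refl
      | @tail a b _ hab ih =>
        rcases hab with hab | ⟨hab, he⟩
        · rwa [← rep_eq a b hab]
        · have h₁ : ¬ s a (rep b) := fun h => hab (s.trans h (hrep b))
          refine ih.tail ⟨hT a, hT b, fun e => hab ?_, ?_⟩
          · exact s.trans (s.symm (hrep a)) (e ▸ hrep b)
          · rw [← hom a (rep a) (rep b) (s.symm (hrep a)) h₁, hc.symm,
              ← hom b (rep b) a (s.symm (hrep b)) (fun h => hab (s.symm h)), hc.symm, he]
    intro x hx y hy
    obtain ⟨x, -, rfl⟩ := Finset.mem_image.1 hx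
    obtain ⟨y, -, rfl⟩ := Finset.mem_image.1 hy
    exact key x y (join i hi x y)
  have hT2 : 2 ≤ T.card := by
    refine Finset.one_lt_card.2 ⟨rep x₀, hT _, rep y₀, hT _, fun e => h₀ ?_⟩
    exact s.trans (s.symm (hrep x₀)) (e ▸ hrep y₀)
  -- With only one color between classes, it serves as both `r` and `b`.
  by_cases hall : ∀ x y, ¬ s x y → c x y = c x₀ y₀
  · exact ⟨s, c x₀ y₀, c x₀ y₀, hom, fun x y h => .inl (hall x y h),
      occurs _ ⟨_, _, h₀, rfl⟩, occurs _ ⟨_, _, h₀, rfl⟩⟩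
  · push Not at hall
    obtain ⟨x₁, y₁, h₁, hne⟩ := hall
    refine ⟨s, c x₀ y₀, c x₁ y₁, hom, fun x y h => ?_,
      occurs _ ⟨_, _, h₀, rfl⟩, occurs _ ⟨_, _, h₁, rfl⟩⟩
    by_contra! hxy
    exact hc.not_colorConnected hxy.1 hxy.2 hne.symm T hT2
      ⟨conn _ ⟨_, _, h, rfl⟩, conn _ ⟨_, _, h₀, rfl⟩, conn _ ⟨_, _, h₁, rfl⟩⟩

end Gallai

/-- No vertex of a triangle of color `i` has `N` neighbors in color `i`. For `N = t - 1` this says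
that there is no monochromatic copy of `starPlus t`. -/
def StarPlusFree {V K : Type*} (N : ℕ) (c : V → V → K) : Prop :=
  ∀ (v : V) (D : Finset V) (i : K), N ≤ D.card → (∀ x ∈ D, x ≠ v ∧ c v x = i) →
    ∀ x ∈ D, ∀ y ∈ D, x ≠ y → c x y ≠ i

/-! ### Upper bound -/

section Bound

variable {V W K : Type*} {c : V → V → K} {N : ℕ}

theorem IsGallai.comap (hc : IsGallai c) (f : W ↪ V) : IsGallai fun x y => c (f x) (f y) where
  symm _ _ := hc.symm _ _
  triangle _ _ _ h₁ h₂ h₃ := hc.triangle _ _ _ (f.injective.ne h₁) (f.injective.ne h₂)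
    (f.injective.ne h₃)

theorem StarPlusFree.comap (hN : StarPlusFree N c) (f : W ↪ V) :
    StarPlusFree N fun x y => c (f x) (f y) := by
  intro v D i hD hv x hx y hy hxy
  refine hN (f v) (D.map f) i (by simpa using hD) ?_ (f x) (Finset.mem_map_of_mem _ hx) (f y)
    (Finset.mem_map_of_mem _ hy) (f.injective.ne hxy)
  simp only [Finset.mem_map, forall_exists_index, and_imp]
  rintro _ a ha rfl
  exact ⟨f.injective.ne (hv a ha).1, (hv a ha).2⟩

/-- An upper bound, sharp for `2 ≤ N`, for the number of vertices in a coloring with `k` colors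
without a rainbow triangle that satisfies `StarPlusFree N`. -/
def extremalOrder (N : ℕ) : ℕ → ℕ
  | 0 => 1
  | 1 => N
  | 2 => max (2 * N) 5
  | k + 3 => 5 * extremalOrder N (k + 1)

theorem le_extremalOrder (N k : ℕ) : N ≤ extremalOrder N (k + 1) := by
  induction k using Nat.twoStepInduction with
  | zero => exact le_rfl
  | one => simp only [extremalOrder]; omega
  | more k ih _ => simp only [extremalOrder]; omega

/-- Ensures that the factor 5 case dominates the factor 2 case in the recursion; equality can occur
for `N = 2`. -/
theorem two_mul_extremalOrder_le (hN : 2 ≤ N) (k : ℕ) :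
    2 * extremalOrder N (k + 1) ≤ extremalOrder N (k + 2) := by
  induction k using Nat.twoStepInduction with
  | zero => simp only [extremalOrder]; omega
  | one => simp only [extremalOrder]; omega
  | more k ih _ =>
    rw [show extremalOrder N (k + 2 + 1) = 5 * extremalOrder N (k + 1) from rfl,
      show extremalOrder N (k + 2 + 2) = 5 * extremalOrder N (k + 2) from rfl]
    omega

/-- A monochromatic clique has at most `N` vertices. -/
theorem StarPlusFree.card_clique_le (hS : StarPlusFree N c) (hN : 2 ≤ N) {i : K} (P : Finset V)
    (hP : ∀ x ∈ P, ∀ y ∈ P, x ≠ y → c x y = i) : P.card ≤ N := by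
  classical
  by_contra! h
  obtain ⟨v, hv⟩ : P.Nonempty := Finset.card_pos.1 (by omega)
  have hc := Finset.card_erase_of_mem hv
  obtain ⟨x, hx, y, hy, hxy⟩ := Finset.one_lt_card.1 (show 1 < (P.erase v).card by omega)
  refine hS v (P.erase v) i (by omega) (fun a ha => ?_) x hx y hy hxy
    (hP x (Finset.mem_of_mem_erase hx) y (Finset.mem_of_mem_erase hy) hxy)
  exact ⟨Finset.ne_of_mem_erase ha,
    hP v hv a (Finset.mem_of_mem_erase ha) (Finset.ne_of_mem_erase ha).symm⟩

/-- A neighborhood in one color with at least `N` vertices is a clique in the other, so degrees are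
at most `N` and there are at most `2 * N + 1` vertices. In case of equality all degrees are `N`, and
a vertex of such a clique sees a further edge of it in the same color once `N ≥ 3`. -/
theorem StarPlusFree.card_le_of_two_colors [Fintype V] (hS : StarPlusFree N c)
    (hN : 2 ≤ N) {r b : K}
    (hc : ∀ x y, x ≠ y → c x y = r ∨ c x y = b) : Fintype.card V ≤ max (2 * N) 5 := by
  classical
  rcases eq_or_ne r b with rfl | hrb
  · have := hS.card_clique_le hN (i := r) Finset.univ (fun x _ y _ h => by simpa using hc x y h)
    rw [Finset.card_univ] at this
    omega
  by_contra! hcard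
  have hcard1 : 2 * N < Fintype.card V := lt_of_le_of_lt (le_max_left _ _) hcard
  have hcard2 : 5 < Fintype.card V := lt_of_le_of_lt (le_max_right _ _) hcard
  let D : V → K → Finset V := fun v i => Finset.univ.filter fun x => x ≠ v ∧ c v x = i
  have mem : ∀ v i x, x ∈ D v i ↔ x ≠ v ∧ c v x = i := fun v i x => by simp [D]
  have indep : ∀ v i, N ≤ (D v i).card → ∀ x ∈ D v i, ∀ y ∈ D v i, x ≠ y → c x y ≠ i :=
    fun v i h => hS v (D v i) i h fun x hx => (mem v i x).1 hx
  have le : ∀ v, (D v r).card ≤ N ∧ (D v b).card ≤ N := by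
    intro v
    constructor
    · by_contra! h
      refine absurd (hS.card_clique_le hN (i := b) _ fun x hx y hy hxy => ?_) (not_le.2 h)
      exact (hc x y hxy).resolve_left (indep v r h.le x hx y hy hxy)
    · by_contra! h
      refine absurd (hS.card_clique_le hN (i := r) _ fun x hx y hy hxy => ?_) (not_le.2 h)
      exact (hc x y hxy).resolve_right (indep v b h.le x hx y hy hxy)
  have sum : ∀ v, Fintype.card V ≤ 1 + (D v r).card + (D v b).card := by
    intro v
    have : (Finset.univ : Finset V) ⊆ {v} ∪ D v r ∪ D v b := by
      intro x _
      by_cases h : x = v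
      · simp [h]
      · rcases hc v x (Ne.symm h) with e | e <;> simp [mem, h, e]
    calc Fintype.card V = (Finset.univ : Finset V).card := rfl
      _ ≤ _ := Finset.card_le_card this
      _ ≤ _ := Finset.card_union_le _ _
      _ ≤ _ := by
        have := Finset.card_union_le {v} (D v r)
        rw [Finset.card_singleton] at this
        omega
  obtain ⟨v⟩ : Nonempty V := Fintype.card_pos_iff.1 (by omega)
  have h₁ := le v
  have h₂ := sum v
  obtain ⟨u, hu⟩ : (D v r).Nonempty := Finset.card_pos.1 (by omega)
  have her := Finset.card_erase_of_mem hu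
  obtain ⟨x, hx, y, hy, hxy⟩ := Finset.one_lt_card.1 (show 1 < ((D v r).erase u).card by omega)
  have blue : ∀ x ∈ D v r, ∀ y ∈ D v r, x ≠ y → c x y = b := fun x hx y hy hxy =>
    (hc x y hxy).resolve_left (indep v r (by omega) x hx y hy hxy)
  have hub : ∀ x ∈ (D v r).erase u, x ∈ D u b := fun x hx =>
    (mem _ _ _).2 ⟨Finset.ne_of_mem_erase hx,
      blue u hu x (Finset.mem_of_mem_erase hx) (Finset.ne_of_mem_erase hx).symm⟩
  have h₃ := le u
  have h₄ := sum u
  exact indep u b (by omega) x (hub x hx) y (hub y hy) hxy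
    (blue x (Finset.mem_of_mem_erase hx) y (Finset.mem_of_mem_erase hy) hxy)

theorem IsGallai.card_le_of_bounds [Fintype V] (hc : IsGallai c) (hS : StarPlusFree N c)
    (S : Finset K) (hcS : ∀ x y, x ≠ y → c x y ∈ S) {F₁ F₂ : ℕ} (hF₁ : N ≤ F₁) (hF₂ : N ≤ F₂)
    (h₁ : ∀ (P : Finset V) (S' : Finset K), S'.card + 1 = S.card →
      (∀ x ∈ P, ∀ y ∈ P, x ≠ y → c x y ∈ S') → P.card ≤ F₁)
    (h₂ : ∀ (P : Finset V) (S' : Finset K), S'.card + 2 = S.card →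
      (∀ x ∈ P, ∀ y ∈ P, x ≠ y → c x y ∈ S') → P.card ≤ F₂) [Nontrivial V] :
    Fintype.card V ≤ max (2 * F₁) (5 * F₂) := by
  classical
  obtain ⟨s, r, b, hom, hcol, hr, hb⟩ := hc.exists_partition
  have ne : ∀ {p q}, ¬ s p q → p ≠ q := fun h e => h (e ▸ s.refl _)
  have hmem : ∀ {i}, (∀ x, ∃ y, ¬ s x y ∧ c x y = i) → i ∈ S := by
    intro i hi
    obtain ⟨x⟩ : Nonempty V := inferInstance
    obtain ⟨y, hxy, he⟩ := hi x
    exact he ▸ hcS x y (ne hxy)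
  have hrS := hmem hr
  have hbS := hmem hb
  let A : V → Finset V := fun v => Finset.univ.filter fun x => s v x
  have memA : ∀ v x, x ∈ A v ↔ s v x := fun v x => by simp [A]
  have class_ne : ∀ i, (∀ x, ∃ y, ¬ s x y ∧ c x y = i) → ∀ v, N ≤ (A v).card →
      ∀ x ∈ A v, ∀ y ∈ A v, x ≠ y → c x y ≠ i := by
    intro i hi v hv
    obtain ⟨w, hw, hwi⟩ := hi v
    refine hS w (A v) i hv fun x hx => ?_
    rw [memA] at hx
    have hxw : ¬ s x w := fun h => hw (s.trans hx h)
    exact ⟨ne hxw, by rw [hc.symm, ← hom v x w hx hw, hwi]⟩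
  obtain ⟨v⟩ : Nonempty V := inferInstance
  rcases eq_or_ne r b with rfl | hrb
  · have hA : (A v).card ≤ F₁ := by
      by_cases hlt : (A v).card < N
      · omega
      · refine h₁ _ (S.erase r) (Finset.card_erase_add_one hrS) fun x hx y hy hxy => ?_
        exact Finset.mem_erase.2 ⟨class_ne r hr v (by omega) x hx y hy hxy, hcS x y hxy⟩
    have hB : (A v)ᶜ.card ≤ F₁ := by
      by_cases hlt : (A v)ᶜ.card < N
      · omega
      · refine h₁ _ (S.erase r) (Finset.card_erase_add_one hrS) fun x hx y hy hxy => ?_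
        refine Finset.mem_erase.2 ⟨?_, hcS x y hxy⟩
        refine hS v (A v)ᶜ r (by omega) (fun z hz => ?_) x hx y hy hxy
        rw [Finset.mem_compl, memA] at hz
        exact ⟨(ne hz).symm, by simpa using hcol v z hz⟩
    have := Finset.card_add_card_compl (A v)
    exact le_max_of_le_left (by omega)
  · have hA : ∀ v, (A v).card ≤ F₂ := by
      intro v
      by_cases hlt : (A v).card < N
      · omega
      · refine h₂ _ ((S.erase r).erase b) ?_ fun x hx y hy hxy => ?_
        · have e₁ := Finset.card_erase_add_one hrS
          have e₂ := Finset.card_erase_add_one (Finset.mem_erase.2 ⟨hrb.symm, hbS⟩)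
          omega
        · exact Finset.mem_erase.2 ⟨class_ne b hb v (by omega) x hx y hy hxy,
            Finset.mem_erase.2 ⟨class_ne r hr v (by omega) x hx y hy hxy, hcS x y hxy⟩⟩
    let D : K → Finset V := fun i => Finset.univ.filter fun x => ¬ s v x ∧ c v x = i
    have memD : ∀ i x, x ∈ D i ↔ ¬ s v x ∧ c v x = i := fun i x => by simp [D]
    have hD : ∀ i j, (∀ x y, ¬ s x y → c x y = i ∨ c x y = j) → (D i).card ≤ 2 * F₂ := by
      intro i j hij
      by_cases hlt : (D i).card < N
      · omega
      have hne := hS v (D i) i (by omega) fun x hx =>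
        ⟨(ne ((memD _ _).1 hx).1).symm, ((memD _ _).1 hx).2⟩
      have hj : ∀ x ∈ D i, ∀ y ∈ D i, ¬ s x y → c x y = j := fun x hx y hy hxy =>
        (hij x y hxy).resolve_left (hne x hx y hy (ne hxy))
      by_cases h3 : ∃ x ∈ D i, ∃ y ∈ D i, ∃ z ∈ D i, ¬ s x y ∧ ¬ s x z ∧ ¬ s y z
      · obtain ⟨x, hx, y, hy, z, hz, hxy, hxz, hyz⟩ := h3
        -- `x` sees all of `D i \ A x` in color `j`, and this set contains the edge `y z` of color
        -- `j`.
        have hlt : (D i \ A x).card < N := by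
          by_contra! hle
          refine hS x (D i \ A x) j hle (fun w hw => ?_) y ?_ z ?_ (ne hyz) (hj y hy z hz hyz)
          · rw [Finset.mem_sdiff, memA] at hw
            exact ⟨(ne hw.2).symm, hj x hx w hw.1 hw.2⟩
          · simp [hy, memA, hxy]
          · simp [hz, memA, hxz]
        have := Finset.card_le_card_sdiff_add_card (s := D i) (t := A x)
        have := hA x
        omega
      · push Not at h3
        rcases (D i).eq_empty_or_nonempty with h | ⟨x, hx⟩
        · simp [h]
        have hsub : ∃ y, D i ⊆ A x ∪ A y := by
          by_cases hy : ∃ y ∈ D i, ¬ s x y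
          · obtain ⟨y, hy, hxy⟩ := hy
            refine ⟨y, fun z hz => ?_⟩
            rw [Finset.mem_union, memA, memA]
            by_contra! h
            exact h.2 (h3 x hx y hy z hz hxy h.1)
          · push Not at hy
            exact ⟨x, fun z hz => Finset.mem_union_left _ ((memA _ _).2 (hy z hz))⟩
        obtain ⟨y, hy⟩ := hsub
        have := (Finset.card_le_card hy).trans (Finset.card_union_le _ _)
        have := hA x
        have := hA y
        omega
    have hDr := hD r b hcol
    have hDb := hD b r fun x y h => (hcol x y h).symm
    have hsub : (Finset.univ : Finset V) ⊆ A v ∪ (D r ∪ D b) := by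
      intro x _
      rw [Finset.mem_union, Finset.mem_union, memA, memD, memD]
      by_cases h : s v x
      · exact .inl h
      · exact .inr ((hcol v x h).imp (fun e => ⟨h, e⟩) fun e => ⟨h, e⟩)
    have e₁ := (Finset.card_le_card hsub).trans (Finset.card_union_le _ _)
    have e₂ := Finset.card_union_le (D r) (D b)
    have e₃ := hA v
    rw [Finset.card_univ] at e₁
    exact le_max_of_le_right (by omega)

end Bound

/-- The palette `S` lets the number of colors drop in the induction while the type `K` stays fixed.
-/
theorem IsGallai.card_le_extremalOrder {K : Type*} {N : ℕ} (hN : 2 ≤ N) (k : ℕ) :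
    ∀ {V : Type*} [Fintype V] {c : V → V → K}, IsGallai c → StarPlusFree N c →
      ∀ S : Finset K, S.card = k → (∀ x y, x ≠ y → c x y ∈ S) →
        Fintype.card V ≤ extremalOrder N k := by
  classical
  induction k using Nat.strong_induction_on with
  | _ k ih =>
  intro V _ c hc hS S hk hcS
  have sub : ∀ l < k, ∀ (P : Finset V) (S' : Finset K), S'.card = l →
      (∀ x ∈ P, ∀ y ∈ P, x ≠ y → c x y ∈ S') → P.card ≤ extremalOrder N l := by
    intro l hl P S' hS' hP
    have := ih l hl (hc.comap (Function.Embedding.subtype (· ∈ P)))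
      (hS.comap (Function.Embedding.subtype (· ∈ P))) S' hS'
      (fun x y hxy => hP x x.2 y y.2 fun e => hxy (Subtype.ext e))
    simpa using this
  match k, hk with
  | 0, hk =>
    rw [Finset.card_eq_zero] at hk
    subst hk
    refine Fintype.card_le_one_iff.2 fun x y => ?_
    by_contra h
    simpa using hcS x y h
  | 1, hk =>
    obtain ⟨i, rfl⟩ := Finset.card_eq_one.1 hk
    exact hS.card_clique_le hN (i := i) Finset.univ fun x _ y _ h => by simpa using hcS x y h
  | 2, hk =>
    obtain ⟨r, b, -, rfl⟩ := Finset.card_eq_two.1 hk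
    exact hS.card_le_of_two_colors hN (r := r) (b := b) fun x y h => by
      simpa using hcS x y h
  | l + 3, hk =>
    rcases subsingleton_or_nontrivial V with _ | _
    · have h₁ := Fintype.card_le_one_iff_subsingleton.2 ‹Subsingleton V›
      exact h₁.trans ((one_le_two.trans hN).trans (le_extremalOrder N (l + 2)))
    · refine (hc.card_le_of_bounds hS S hcS (le_extremalOrder N (l + 1)) (le_extremalOrder N l)
        (fun P S' h => sub (l + 2) (by omega) P S' (by omega))
        (fun P S' h => sub (l + 1) (by omega) P S' (by omega))).trans ?_
      exact max_le (two_mul_extremalOrder_le hN (l + 1)) le_rfl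

/-! ### Lower bound by substitution -/

section Construction

variable {V W : Type*} {N k : ℕ}

/-- Replace each vertex of a complete graph colored by `d` by a copy of one colored by `c`. -/
def lexColoring [DecidableEq W] (d : W → W → ℕ) (c : V → V → ℕ) (p q : W × V) : ℕ :=
  if p.1 = q.1 then c p.2 q.2 else d p.1 q.1

theorem isGallai_lexColoring [DecidableEq W] {d : W → W → ℕ} {c : V → V → ℕ} (hd : IsGallai d)
    (hc : IsGallai c) : IsGallai (lexColoring d c) where
  symm p q := by
    unfold lexColoring
    split_ifs with h₁ h₂ h₂
    · exact hc.symm _ _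
    · exact absurd h₁.symm h₂
    · exact absurd h₂.symm h₁
    · exact hd.symm _ _
  triangle := by
    rintro ⟨w₁, x₁⟩ ⟨w₂, x₂⟩ ⟨w₃, x₃⟩ h₁₂ h₂₃ h₁₃
    simp only [lexColoring]
    by_cases e₁₂ : w₁ = w₂
    · subst e₁₂
      by_cases e₂₃ : w₁ = w₃
      · subst e₂₃
        simpa using hc.triangle x₁ x₂ x₃ (by simpa using h₁₂) (by simpa using h₂₃)
          (by simpa using h₁₃)
      · simp [e₂₃]
    · by_cases e₂₃ : w₂ = w₃
      · subst e₂₃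
        simp [e₁₂]
      · by_cases e₁₃ : w₁ = w₃
        · subst e₁₃
          simp [e₁₂, e₂₃, hd.symm w₂ w₁]
        · simpa [e₁₂, e₂₃, e₁₃] using hd.triangle w₁ w₂ w₃ e₁₂ e₂₃ e₁₃

/-- The two palettes are disjoint, so a forbidden configuration either lies in one fiber or projects
to a monochromatic triangle of `d`. -/
theorem starPlusFree_lexColoring [DecidableEq W] {d : W → W → ℕ} {c : V → V → ℕ}
    (hd : ∀ x y z, x ≠ y → y ≠ z → x ≠ z → ¬ (d x y = d x z ∧ d y z = d x z))
    (hdk : ∀ x y, k ≤ d x y) (hck : ∀ x y, c x y < k) (hc : StarPlusFree N c) :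
    StarPlusFree N (lexColoring d c) := by
  classical
  intro v D i hD hv x hx y hy hxy hi
  rcases lt_or_ge i k with hik | hik
  · have inner : ∀ p q, lexColoring d c p q = i → p.1 = q.1 ∧ c p.2 q.2 = i := by
      intro p q h
      unfold lexColoring at h
      split_ifs at h with e
      · exact ⟨e, h⟩
      · exact absurd (hdk p.1 q.1) (by omega)
    have hfst : ∀ p ∈ D, p.1 = v.1 := fun p hp => (inner _ _ (hv p hp).2).1.symm
    have hinj : Set.InjOn Prod.snd (D : Set (W × V)) := fun p hp q hq h =>
      Prod.ext ((hfst p hp).trans (hfst q hq).symm) h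
    refine hc v.2 (D.image Prod.snd) i (by rwa [Finset.card_image_of_injOn hinj]) ?_ x.2
      (Finset.mem_image_of_mem _ hx) y.2 (Finset.mem_image_of_mem _ hy)
      (fun h => hxy (hinj hx hy h)) (inner _ _ hi).2
    intro a ha
    obtain ⟨p, hp, rfl⟩ := Finset.mem_image.1 ha
    exact ⟨fun h => (hv p hp).1 (Prod.ext (hfst p hp) h), (inner _ _ (hv p hp).2).2⟩
  · have outer : ∀ p q, lexColoring d c p q = i → p.1 ≠ q.1 ∧ d p.1 q.1 = i := by
      intro p q h
      unfold lexColoring at h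
      split_ifs at h with e
      · exact absurd (hck p.2 q.2) (by omega)
      · exact ⟨e, h⟩
    obtain ⟨h₁, e₁⟩ := outer _ _ (hv x hx).2
    obtain ⟨h₂, e₂⟩ := outer _ _ (hv y hy).2
    obtain ⟨h₃, e₃⟩ := outer _ _ hi
    exact hd _ _ _ h₁ h₃ h₂ ⟨e₁.trans e₂.symm, e₃.trans e₂.symm⟩

/-- There is a coloring of a complete graph on `n` vertices with `k` colors that has no rainbow
triangle and satisfies `StarPlusFree N`. -/
def HasGoodColoring (N k n : ℕ) : Prop :=
  ∃ (V : Type) (_ : Fintype V) (c : V → V → ℕ), Fintype.card V = n ∧ IsGallai c ∧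
    StarPlusFree N c ∧ ∀ x y, c x y < k

theorem hasGoodColoring_one (N : ℕ) : HasGoodColoring N 1 N := by
  refine ⟨Fin N, inferInstance, fun _ _ => 0, by simp, ⟨fun _ _ => rfl, by simp⟩, ?_, by simp⟩
  intro v D i hD hv
  have : D ⊆ Finset.univ.erase v := fun x hx => by simpa using (hv x hx).1
  have h₁ := Finset.card_le_card this
  rw [Finset.card_erase_of_mem (Finset.mem_univ v), Finset.card_univ, Fintype.card_fin] at h₁
  have := v.pos
  omega

theorem HasGoodColoring.lex {W : Type} [Fintype W] [DecidableEq W] {n l : ℕ}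
    (h : HasGoodColoring N k n) {d : W → W → ℕ} (hd : IsGallai d)
    (hd' : ∀ x y z, x ≠ y → y ≠ z → x ≠ z → ¬ (d x y = d x z ∧ d y z = d x z))
    (hl : ∀ x y, d x y < l) : HasGoodColoring N (k + l) (Fintype.card W * n) := by
  obtain ⟨V, _, c, rfl, hc, hS, hck⟩ := h
  refine ⟨W × V, inferInstance, lexColoring (fun x y => k + d x y) c, by simp,
    isGallai_lexColoring ⟨fun x y => by rw [hd.symm], fun x y z h₁ h₂ h₃ => ?_⟩ hc,
    starPlusFree_lexColoring (k := k) (fun x y z h₁ h₂ h₃ => ?_) (by simp) hck hS, ?_⟩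
  · simpa using hd.triangle x y z h₁ h₂ h₃
  · simpa using hd' x y z h₁ h₂ h₃
  · intro p q
    unfold lexColoring
    split_ifs
    · exact (hck _ _).trans_le (by omega)
    · exact Nat.add_lt_add_left (hl _ _) k

theorem HasGoodColoring.double {n : ℕ} (h : HasGoodColoring N k n) :
    HasGoodColoring N (k + 1) (2 * n) := by
  have := h.lex (W := Fin 2) (l := 1) (d := fun _ _ => 0) ⟨fun _ _ => rfl, by simp⟩
    (by decide) (by simp)
  simpa using this

theorem HasGoodColoring.pentagon {n : ℕ} (h : HasGoodColoring N k n) :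
    HasGoodColoring N (k + 2) (5 * n) := by
  have := h.lex (W := Fin 5) (l := 2)
    -- The 5-cycle and its complement, again a 5-cycle: neither contains a triangle.
    (d := fun x y => if x - y = 1 ∨ y - x = 1 then 0 else 1) ⟨by decide, by decide⟩
    (by decide) (by decide)
  simpa using this

theorem HasGoodColoring.pentagons {n : ℕ} (h : HasGoodColoring N k n) (j : ℕ) :
    HasGoodColoring N (k + 2 * j) (n * 5 ^ j) := by
  induction j with
  | zero => simpa using h
  | succ j ih =>
    have := ih.pentagon
    rwa [show 5 * (n * 5 ^ j) = n * 5 ^ (j + 1) by ring] at this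

end Construction

/-! ### From functions on pairs to edge labelings -/

section Translation

variable {V K : Type*} {C : SimpleGraph.TopEdgeLabeling V K} {c : V → V → K}

theorem isGallai_iff_not_hasRainbowCopy (hsymm : ∀ x y, c x y = c y x)
    (hcC : ∀ x y (h : x ≠ y), C.get x y h = c x y) :
    IsGallai c ↔ ¬ HasRainbowCopy C (⊤ : SimpleGraph (Fin 3)) := by
  constructor
  · rintro hc ⟨f, hf⟩
    have col : ∀ a b (h : a ≠ b),
        C (f.mapEdgeSet ⟨s(a, b), h⟩) = c (f a) (f b) := fun a b h =>
      hcC (f a) (f b) (f.injective.ne h)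
    have key : ∀ a b a' b', a ≠ b → a' ≠ b' → c (f a) (f b) = c (f a') (f b') →
        s(a, b) = s(a', b') := by
      intro a b a' b' h h' e
      rw [← col a b h, ← col a' b' h'] at e
      exact congrArg Subtype.val (hf e)
    rcases hc.triangle (f 0) (f 1) (f 2) (f.injective.ne (by decide)) (f.injective.ne (by decide))
      (f.injective.ne (by decide)) with h | h | h
    · exact absurd (key _ _ _ _ (by decide) (by decide) h) (by decide)
    · exact absurd (key _ _ _ _ (by decide) (by decide) h) (by decide)
    · exact absurd (key _ _ _ _ (by decide) (by decide) h) (by decide)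
  · intro h
    refine ⟨hsymm, fun x y z hxy hyz hxz => ?_⟩
    by_contra! hne
    obtain ⟨h₁, h₂, h₃⟩ := hne
    have hinj : Function.Injective ![x, y, z] := by
      intro a b
      fin_cases a <;> fin_cases b <;> simp [hxy, hyz, hxz, hxy.symm, hyz.symm, hxz.symm]
    refine h ⟨⟨⟨![x, y, z], fun {a b} hab => hinj.ne hab⟩, hinj⟩, ?_⟩
    rintro ⟨e, he⟩ ⟨e', he'⟩
    induction e using Sym2.inductionOn with | _ a b
    induction e' using Sym2.inductionOn with | _ a' b'
    intro heq
    have hab : a ≠ b := he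
    have hab' : a' ≠ b' := he'
    have heq' : c (![x, y, z] a) (![x, y, z] b) = c (![x, y, z] a') (![x, y, z] b') :=
      (hcC _ _ (hinj.ne hab)).symm.trans (Eq.trans heq (hcC _ _ (hinj.ne hab')))
    refine Subtype.ext (show s(a, b) = s(a', b') from ?_)
    clear heq he he'
    have s₁ := hsymm y x
    have s₂ := hsymm z x
    have s₃ := hsymm z y
    fin_cases a <;> fin_cases b <;> first | exact absurd rfl hab | skip
    all_goals
      fin_cases a' <;> fin_cases b' <;>
        first | exact absurd rfl hab' | rfl | exact Sym2.eq_swap | (exfalso; simp_all)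

theorem starPlusFree_iff_not_hasMonochromaticCopy {t : ℕ} (ht : 3 ≤ t)
    (hsymm : ∀ x y, c x y = c y x) (hcC : ∀ x y (h : x ≠ y), C.get x y h = c x y) :
    StarPlusFree (t - 1) c ↔ ¬ HasMonochromaticCopy C (starPlus t ht) := by
  classical
  have adj : ∀ i x y, (C.labelGraph i).Adj x y ↔ x ≠ y ∧ c x y = i := by
    intro i x y
    rw [SimpleGraph.TopEdgeLabeling.labelGraph_adj]
    exact ⟨fun ⟨h, e⟩ => ⟨h, (hcC x y h).symm.trans e⟩, fun ⟨h, e⟩ => ⟨h, (hcC x y h).trans e⟩⟩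
  let z : Fin t := ⟨0, by omega⟩
  let a : Fin t := ⟨1, by omega⟩
  let b : Fin t := ⟨2, by omega⟩
  have hza : z ≠ a := by simp [z, a]
  have hzb : z ≠ b := by simp [z, b]
  have hab : a ≠ b := by simp [a, b]
  have star : ∀ p q, (starPlus t ht).Adj p q ↔
      (p ≠ q ∧ (p = z ∨ q = z)) ∨ ((p = a ∧ q = b ∨ p = b ∧ q = a) ∧ p ≠ q) := by
    intro p q
    rw [starPlus, SimpleGraph.sup_adj, SimpleGraph.starGraph_adj, SimpleGraph.edge_adj]
  constructor
  · rintro hS ⟨i, ⟨f⟩⟩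
    have hcard : ((Finset.univ.erase z).map ⟨f, f.injective⟩).card = t - 1 := by
      rw [Finset.card_map, Finset.card_erase_of_mem (Finset.mem_univ _), Finset.card_univ,
        Fintype.card_fin]
    have hadj : ∀ p q, (starPlus t ht).Adj p q → c (f p) (f q) = i := fun p q h =>
      ((adj i _ _).1 (f.toHom.map_adj h)).2
    refine hS (f z) _ i hcard.ge ?_ (f a) ?_ (f b) ?_ (f.injective.ne hab)
      (hadj a b ((star _ _).2 (.inr ⟨.inl ⟨rfl, rfl⟩, hab⟩)))
    · intro x hx
      obtain ⟨p, hp, rfl⟩ := Finset.mem_map.1 hx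
      have hpz : p ≠ z := Finset.ne_of_mem_erase hp
      exact ⟨f.injective.ne hpz, hadj z p ((star _ _).2 (.inl ⟨hpz.symm, .inl rfl⟩))⟩
    · exact Finset.mem_map_of_mem _ (Finset.mem_erase.2 ⟨hza.symm, Finset.mem_univ _⟩)
    · exact Finset.mem_map_of_mem _ (Finset.mem_erase.2 ⟨hzb.symm, Finset.mem_univ _⟩)
  · intro h v D i hD hv x hx y hy hxy hi
    -- Trim `D` to exactly `t - 1` vertices, keeping `x` and `y`, so that `z, a, b ↦ v, x, y`
    -- extends to a bijection onto `insert v D'`.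
    obtain ⟨D', hsub, hD', hcard⟩ := Finset.exists_subsuperset_card_eq (s := {x, y}) (t := D)
      (n := t - 1) (by simp [Finset.insert_subset_iff, hx, hy])
      (by rw [Finset.card_pair hxy]; omega) hD
    have hvD : v ∉ D' := fun hvD => (hv v (hD' hvD)).1 rfl
    have hxD : x ∈ D' := hsub (by simp)
    have hyD : y ∈ D' := hsub (by simp)
    have hvx : v ≠ x := fun e => hvD (e ▸ hxD)
    have hvy : v ≠ y := fun e => hvD (e ▸ hyD)
    let g : Fin t → V := fun p => if p = z then v else if p = a then x else y
    have gz : g z = v := by simp [g]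
    have ga : g a = x := by simp [g, hza.symm]
    have gb : g b = y := by simp [g, hzb.symm, hab.symm]
    obtain ⟨e, he⟩ := Finset.exists_equiv_extend_of_card_eq (α := Fin t) (t := insert v D')
      (by rw [Finset.card_insert_of_notMem hvD, Fintype.card_fin]; omega)
      (s := {z, a, b}) (f := g)
      (by simp [Finset.insert_subset_iff, gz, ga, gb, hxD, hyD])
      (by
        intro p hp q hq
        simp only [Finset.coe_insert, Finset.coe_singleton, Set.mem_insert_iff,
          Set.mem_singleton_iff] at hp hq
        rcases hp with rfl | rfl | rfl <;> rcases hq with rfl | rfl | rfl <;>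
          simp [gz, ga, gb, hvx, hvy, hxy, hvx.symm, hvy.symm, hxy.symm])
    have ez : (e z : V) = v := (he z (by simp)).trans gz
    have ea : (e a : V) = x := (he a (by simp)).trans ga
    have eb : (e b : V) = y := (he b (by simp)).trans gb
    have hinj : Function.Injective fun p => (e p : V) :=
      Subtype.val_injective.comp e.injective
    have hvc : ∀ p, p ≠ z → c v (e p) = i := by
      intro p hp
      refine (hv _ (hD' ?_)).2
      exact (Finset.mem_insert.1 (e p).2).resolve_left fun h => hp (hinj (h.trans ez.symm))
    refine h ⟨i, ⟨⟨⟨fun p => (e p : V), fun {p q} hpq => (adj i _ _).2 ⟨hinj.ne hpq.ne, ?_⟩⟩,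
      hinj⟩⟩⟩
    rcases (star p q).1 hpq with ⟨hne, rfl | rfl⟩ | ⟨⟨rfl, rfl⟩ | ⟨rfl, rfl⟩, -⟩
    · rw [ez]; exact hvc q hne.symm
    · rw [ez, hsymm]; exact hvc p hne
    · rw [ea, eb, hi]
    · rw [ea, eb, hsymm, hi]

theorem hasRainbowCopy_or_hasMonochromaticCopy_of_lt {k t n : ℕ} (hk : 1 ≤ k) (ht : 3 ≤ t)
    (hn : extremalOrder (t - 1) k < n) (C : SimpleGraph.TopEdgeLabeling (Fin n) (Fin k)) :
    HasRainbowCopy C (⊤ : SimpleGraph (Fin 3)) ∨ HasMonochromaticCopy C (starPlus t ht) := by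
  by_contra! h
  -- The diagonal needs a dummy color, available since `k ≥ 1`.
  let c : Fin n → Fin n → Fin k := fun x y => if h : x ≠ y then C.get x y h else ⟨0, hk⟩
  have hcC : ∀ x y (h : x ≠ y), C.get x y h = c x y := fun x y h => by simp [c, h]
  have hsymm : ∀ x y, c x y = c y x := by
    intro x y
    rcases eq_or_ne x y with rfl | hxy
    · rfl
    · rw [← hcC x y hxy, ← hcC y x hxy.symm]
      exact SimpleGraph.EdgeLabeling.get_comm y x hxy
  have := IsGallai.card_le_extremalOrder (N := t - 1) (by omega) k
    ((isGallai_iff_not_hasRainbowCopy hsymm hcC).2 h.1)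
    ((starPlusFree_iff_not_hasMonochromaticCopy ht hsymm hcC).2 h.2) Finset.univ (by simp)
    (by simp)
  rw [Fintype.card_fin] at this
  omega

/-- Restricting to fewer vertices matters because minimality requires a bad coloring for every
smaller order. -/
theorem HasGoodColoring.exists_labeling {k t n m : ℕ} (ht : 3 ≤ t)
    (h : HasGoodColoring (t - 1) k m) (hn : n ≤ m) :
    ∃ C : SimpleGraph.TopEdgeLabeling (Fin n) (Fin k),
      ¬ (HasRainbowCopy C (⊤ : SimpleGraph (Fin 3)) ∨ HasMonochromaticCopy C (starPlus t ht)) := by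
  obtain ⟨V, _, c, rfl, hc, hS, hck⟩ := h
  obtain ⟨f⟩ : Nonempty (Fin n ↪ V) := Function.Embedding.nonempty_of_card_le (by simpa using hn)
  let c' : Fin n → Fin n → Fin k := fun x y => ⟨c (f x) (f y), hck _ _⟩
  have hval : ∀ x y, (c' x y : ℕ) = c (f x) (f y) := fun _ _ => rfl
  have hsymm : ∀ x y, c' x y = c' y x := fun x y => Fin.ext (hc.symm _ _)
  have hG : IsGallai c' := ⟨hsymm, fun x y z h₁ h₂ h₃ => by
    simpa only [Fin.ext_iff, hval] using (hc.comap f).triangle x y z h₁ h₂ h₃⟩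
  have hS' : StarPlusFree (t - 1) c' := fun v D i hD hv x hx y hy hxy e =>
    (hS.comap f) v D i hD (fun a ha => ⟨(hv a ha).1, congrArg Fin.val (hv a ha).2⟩) x hx y hy hxy
      (congrArg Fin.val e)
  refine ⟨.mk (fun x y _ => c' x y) fun x y _ => hsymm y x, not_or.2 ⟨?_, ?_⟩⟩
  · exact (isGallai_iff_not_hasRainbowCopy hsymm fun _ _ _ => rfl).1 hG
  · exact (starPlusFree_iff_not_hasMonochromaticCopy ht hsymm fun _ _ _ => rfl).1 hS'

theorem isGallaiRamseyNumber_of_hasGoodColoring {k t : ℕ} (hk : 1 ≤ k) (ht : 3 ≤ t)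
    (h : HasGoodColoring (t - 1) k (extremalOrder (t - 1) k)) :
    IsGallaiRamseyNumber k (⊤ : SimpleGraph (Fin 3)) (starPlus t ht)
      (extremalOrder (t - 1) k + 1) := by
  refine ⟨hasRainbowCopy_or_hasMonochromaticCopy_of_lt hk ht (Nat.lt_succ_self _), fun n hn => ?_⟩
  by_contra! hlt
  obtain ⟨C, hC⟩ := h.exists_labeling ht (Nat.lt_succ_iff.1 hlt)
  exact hC (hn C)

end Translation

/-! ### Closed forms and the final theorem -/

theorem extremalOrder_odd (N j : ℕ) : extremalOrder N (2 * j + 1) = N * 5 ^ j := by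
  induction j with
  | zero => simp [extremalOrder]
  | succ j ih =>
    rw [show 2 * (j + 1) + 1 = 2 * j + 3 by ring, extremalOrder, ih, pow_succ]
    ring

theorem extremalOrder_even {N : ℕ} (hN : 3 ≤ N) (j : ℕ) :
    extremalOrder N (2 * j + 2) = 2 * N * 5 ^ j := by
  induction j with
  | zero => simp only [extremalOrder, pow_zero, mul_one]; omega
  | succ j ih =>
    rw [show 2 * (j + 1) + 2 = (2 * j + 1) + 3 by ring, extremalOrder, ih, pow_succ]
    ring

end GallaiRamsey

theorem theorem3p3 (k t : ℕ) (hk : 1 ≤ k) (ht : 3 ≤ t) (h3 : t = 3 → Odd k) :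
    (Even k → GallaiRamsey.IsGallaiRamseyNumber k (⊤ : SimpleGraph (Fin 3))
      (GallaiRamsey.starPlus t ht) (2 * (t - 1) * 5 ^ ((k - 2) / 2) + 1)) ∧
    (Odd k → GallaiRamsey.IsGallaiRamseyNumber k (⊤ : SimpleGraph (Fin 3))
      (GallaiRamsey.starPlus t ht) ((t - 1) * 5 ^ ((k - 1) / 2) + 1)) := by
  constructor
  · intro hev
    have ht3 : t ≠ 3 := fun h => Nat.not_even_iff_odd.2 (h3 h) hev
    obtain ⟨j, rfl⟩ : ∃ j, k = 2 * j + 2 := by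
      obtain ⟨m, rfl⟩ := hev
      exact ⟨m - 1, by omega⟩
    have e := GallaiRamsey.extremalOrder_even (show 3 ≤ t - 1 by omega) j
    rw [show (2 * j + 2 - 2) / 2 = j by omega, ← e]
    refine GallaiRamsey.isGallaiRamseyNumber_of_hasGoodColoring hk ht ?_
    rw [e, show 2 * j + 2 = 1 + 1 + 2 * j by ring]
    exact (GallaiRamsey.hasGoodColoring_one (t - 1)).double.pentagons j
  · rintro ⟨j, rfl⟩
    have e := GallaiRamsey.extremalOrder_odd (t - 1) j
    rw [show (2 * j + 1 - 1) / 2 = j by omega, ← e]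
    refine GallaiRamsey.isGallaiRamseyNumber_of_hasGoodColoring hk ht ?_
    rw [e, show 2 * j + 1 = 1 + 2 * j by ring]
    exact (GallaiRamsey.hasGoodColoring_one (t - 1)).pentagons j
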